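/- Let $d\ge 2$ and $t\ge 1$ be integers. A $t$-online-erasure oracle for a function $f\colon\{0,1\}^d\to\{0,1\}$ answers queries $x\in\{0,1\}^d$ one after another. The answer to $x$ is $f(x)$ if $x$ has not been erased so far, and the symbol $\perp$ otherwise. Before the first query nothing is erased, and after answering each query the oracle permanently erases at most $t$ points of its choice, depending on $f$ and on the queries made so far (and on the code of the algorithm, but not on its future coin tosses). A function $f\colon\{0,1\}^d\to\{0,1\}$ is linear if $f(x)=\sum_{i\in I}x_i \pmod 2$ for some $I\subseteq\{1,\dots,d\}$, and it is $\varepsilon$-far from linear if it differs from each linear function on at least an $\varepsilon$ fraction of the points of $\{0,1\}^d$. A $t$-online-erasure-resilient $\varepsilon$-tester for linearity is a randomized adaptive query algorithm which, against every strategy of a $t$-online-erasure oracle for $f$, accepts with probability at least $2/3$ if $f$ is linear and rejects with probability at least $2/3$ if $f$ is $\varepsilon$-far from linear. **Theorem.** For all $\varepsilon\in(0,\frac14]$, every $t$-online-erasure-resilient $\varepsilon$-tester for linearity of functions $f\colon\{0,1\}^d\to\{0,1\}$ must make more than $\log_2 t$ queries in the worst case: there are a function $f$ and a strategy of the $t$-online-erasure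 oracle for which the tester makes more than $\log_2 t$ queries with positive probability. -/

import Mathlib

namespace OnlineErasure

/-- A deterministic adaptive query algorithm for functions `α → β`, as a decision tree: it either
stops with a verdict (`true` means accept), or queries a point and continues depending on the
answer, which is a value of the function or the symbol `⊥` (here `none`) for an erased point. -/
inductive QueryAlgorithm (α β : Type) : Type
  | output (accept : Bool) : QueryAlgorithm α β
  | query (x : α) (next : Option β → QueryAlgorithm α β) : QueryAlgorithm α β

/-- A strategy of a `t`-online-erasure oracle. `erase f h` is the set of at most `t` points that
are erased right after the oracle has answered the last query, when the input is `f` and the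
(nonempty) list of all queries made so far, most recent first, is `h`. The answers are determined
by `f`, the queries and the strategy, so a strategy does not need them as an argument. -/
structure ErasureStrategy (α β : Type) (t : ℕ) where
  erase : (α → β) → List α → Finset α
  card_erase_le : ∀ (f : α → β) (h : List α), (erase f h).card ≤ t

/-- The set of all points erased after the queries in `h` (most recent first). Nothing is erased
before the first query has been answered, and erasures are permanent. -/
def ErasureStrategy.erased {α β : Type} {t : ℕ} [DecidableEq α] (S : ErasureStrategy α β t)
    (f : α → β) : List α → Finset α
  | [] => ∅
  | x :: h => ErasureStrategy.erased S f h ∪ S.erase f (x :: h)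

/-- The answer to the query `x` that is made after the queries in `h`. -/
def ErasureStrategy.answer {α β : Type} {t : ℕ} [DecidableEq α] (S : ErasureStrategy α β t)
    (f : α → β) (h : List α) (x : α) : Option β :=
  if x ∈ S.erased f h then none else some (f x)

/-- The verdict of the algorithm on input `f` against the strategy `S`, when the queries in `h`
have already been made. -/
def QueryAlgorithm.verdict {α β : Type} {t : ℕ} [DecidableEq α] (S : ErasureStrategy α β t)
    (f : α → β) : QueryAlgorithm α β → List α → Bool
  | .output b, _ => b
  | .query x next, h => QueryAlgorithm.verdict S f (next (S.answer f h x)) (x :: h)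

/-- The number of queries the algorithm makes on input `f` against the strategy `S`, when the
queries in `h` have already been made (these are not counted). -/
def QueryAlgorithm.numQueries {α β : Type} {t : ℕ} [DecidableEq α] (S : ErasureStrategy α β t)
    (f : α → β) : QueryAlgorithm α β → List α → ℕ
  | .output _, _ => 0
  | .query x next, h => QueryAlgorithm.numQueries S f (next (S.answer f h x)) (x :: h) + 1

/-- `f` is `ε`-far from the property `P`: it differs from each member of `P` on at least an `ε`
fraction of the domain. -/
def IsFar {α β : Type} [Fintype α] [DecidableEq β] (ε : ℝ) (P : Set (α → β)) (f : α → β) : Prop :=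
  ∀ g ∈ P, ε ≤ ((Finset.univ.filter fun x => f x ≠ g x).card : ℝ) / (Fintype.card α : ℝ)

/-- A randomized algorithm is a probability distribution `T` on deterministic algorithms. It is a
`t`-online-erasure-resilient `ε`-tester for `P` if, against every strategy of a `t`-online-erasure
oracle, it accepts each `f ∈ P` with probability at least `2/3` and rejects each `f` that is
`ε`-far from `P` with probability at least `2/3`. The strategy does not see which deterministic
algorithm was drawn from `T`. -/
def IsResilientTester {α β : Type} [Fintype α] [DecidableEq α] [DecidableEq β] (t : ℕ) (ε : ℝ)
    (P : Set (α → β)) (T : PMF (QueryAlgorithm α β)) : Prop :=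
  ∀ (S : ErasureStrategy α β t) (f : α → β),
    (f ∈ P → (2 / 3 : ENNReal) ≤ (T.map fun A => A.verdict S f []) true) ∧
    (IsFar ε P f → (2 / 3 : ENNReal) ≤ (T.map fun A => A.verdict S f []) false)

/-- The linear Boolean functions on `{0,1}^d`: sums modulo 2 of monomials `x[i]`. -/
def linearFunctions (d : ℕ) : Set ((Fin d → ZMod 2) → ZMod 2) :=
  {f | ∃ I : Finset (Fin d), ∀ x, f x = ∑ i ∈ I, x i}

end OnlineErasure

namespace OnlineErasure

open Finset

/-! The oracle erases the span of all queries, which is possible while `2 ^ q ≤ t` after `q`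
queries. A later query inside the span returns `⊥`, and a first query at `0` returns `0`; neither
carries information. A query outside the span splits the linear functions consistent with the past
evenly by its answer, and adding a fixed `Q` with `Q 0 = 0` only permutes these answers. Hence a
deterministic algorithm within the budget accepts equally many functions `b ⬝ᵥ x` as functions `Q x
+ b ⬝ᵥ x` (`card_acceptedShifts_eq`).

For `Q = x i * x j` every function of the second kind is `1/4`-far from linear
(`isFar_mul_add_dotProduct`). A tester would have to accept the first kind and reject the second
with average probability at least `2/3` each, but these two averages sum to `1`. -/

/-- The span of the points of a list over `ZMod 2`. -/
def listSpan {d : ℕ} (h : List (Fin d → ZMod 2)) : Submodule (ZMod 2) (Fin d → ZMod 2) :=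
  Submodule.span (ZMod 2) (h.toFinset : Set (Fin d → ZMod 2))

lemma mem_listSpan {d : ℕ} {h : List (Fin d → ZMod 2)} {x : Fin d → ZMod 2} (hx : x ∈ h) :
    x ∈ listSpan h :=
  Submodule.subset_span (by simpa using hx)

lemma listSpan_le_cons {d : ℕ} (x : Fin d → ZMod 2) (h : List (Fin d → ZMod 2)) :
    listSpan h ≤ listSpan (x :: h) :=
  Submodule.span_mono (by simp)

lemma card_listSpan_le {d : ℕ} (h : List (Fin d → ZMod 2)) :
    Nat.card (listSpan h) ≤ 2 ^ h.length := by
  rw [Module.natCard_eq_pow_finrank (K := ZMod 2), Nat.card_zmod]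
  exact Nat.pow_le_pow_right two_pos
    ((finrank_span_finset_le_card h.toFinset).trans h.toFinset_card_le)

/-- The strategy that erases the span of all queries as long as this span is guaranteed to have
at most `t` points. -/
noncomputable def spanStrategy (d t : ℕ) : ErasureStrategy (Fin d → ZMod 2) (ZMod 2) t where
  erase _ h := if 2 ^ h.length ≤ t then (Set.toFinite (listSpan h : Set _)).toFinset else ∅
  card_erase_le f h := by
    split_ifs with ht
    · refine le_trans ?_ ht
      rw [← Set.ncard_eq_toFinset_card]
      exact card_listSpan_le h
    · simp

lemma mem_listSpan_of_mem_erased {d t : ℕ} (f : (Fin d → ZMod 2) → ZMod 2)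
    (h : List (Fin d → ZMod 2)) {x : Fin d → ZMod 2} (hx : x ∈ (spanStrategy d t).erased f h) :
    x ∈ listSpan h := by
  induction h with
  | nil => simp [ErasureStrategy.erased] at hx
  | cons y h ih =>
    rw [ErasureStrategy.erased, mem_union] at hx
    rcases hx with hx | hx
    · exact listSpan_le_cons y h (ih hx)
    · by_cases ht : 2 ^ (y :: h).length ≤ t
      · simpa only [spanStrategy, if_pos ht, Set.Finite.mem_toFinset, SetLike.mem_coe] using hx
      · simp only [spanStrategy, if_neg ht, notMem_empty] at hx

/-- The last erasure alone already covers the span. Nonemptiness matters: the span of no queries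
contains `0`, yet nothing is erased at the start. -/
lemma mem_erased_iff {d t : ℕ} (f : (Fin d → ZMod 2) → ZMod 2) {h : List (Fin d → ZMod 2)}
    (h0 : h ≠ []) (ht : 2 ^ h.length ≤ t) (x : Fin d → ZMod 2) :
    x ∈ (spanStrategy d t).erased f h ↔ x ∈ listSpan h := by
  refine ⟨mem_listSpan_of_mem_erased f h, fun hx => ?_⟩
  cases h with
  | nil => exact absurd rfl h0
  | cons y h =>
    rw [ErasureStrategy.erased, mem_union]
    right
    simpa only [spanStrategy, if_pos ht, Set.Finite.mem_toFinset, SetLike.mem_coe] using hx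

lemma dotProduct_eq_of_mem_listSpan {d : ℕ} {h : List (Fin d → ZMod 2)} {a b : Fin d → ZMod 2}
    (hab : ∀ y ∈ h, a ⬝ᵥ y = b ⬝ᵥ y) {x : Fin d → ZMod 2} (hx : x ∈ listSpan h) :
    a ⬝ᵥ x = b ⬝ᵥ x := by
  induction hx using Submodule.span_induction with
  | mem x hx => exact hab x (by simpa using hx)
  | zero => simp
  | add x y _ _ hx hy => rw [dotProduct_add, dotProduct_add, hx, hy]
  | smul c x _ hx => rw [dotProduct_smul, dotProduct_smul, hx]

/-- The values of a linear function on `h` do not restrict its value outside of the span of `h`. -/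
lemma exists_dotProduct_eq {d : ℕ} {h : List (Fin d → ZMod 2)} (a : Fin d → ZMod 2)
    {x : Fin d → ZMod 2} (hx : x ∉ listSpan h) (c : ZMod 2) :
    ∃ b : Fin d → ZMod 2, (∀ y ∈ h, b ⬝ᵥ y = a ⬝ᵥ y) ∧ b ⬝ᵥ x = c := by
  obtain ⟨φ, hφx, hφ⟩ := Submodule.exists_le_ker_of_notMem hx
  have key : ∀ y, (dotProductEquiv (ZMod 2) (Fin d)).symm φ ⬝ᵥ y = φ y := fun y => by
    rw [← dotProductEquiv_apply_apply, LinearEquiv.apply_symm_apply]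
  -- The vector representing `φ` is orthogonal to `h` but not to `x`; its coefficient is solved from
  -- the required value `c` at `x`.
  refine ⟨a + ((c - a ⬝ᵥ x) / φ x) • (dotProductEquiv (ZMod 2) (Fin d)).symm φ,
    fun y hy => ?_, ?_⟩
  · have : φ y = 0 := hφ (mem_listSpan hy)
    rw [add_dotProduct, smul_dotProduct, key, this, smul_zero, add_zero]
  · rw [add_dotProduct, smul_dotProduct, key, smul_eq_mul, div_mul_cancel₀ _ hφx,
      add_sub_cancel]

/-- The vectors whose linear functions agree with that of `a` on `h` and for which the algorithm
accepts the sum of the linear function and `Q`, when the queries in `h` have been made. -/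
noncomputable def acceptedShifts {d : ℕ} (t : ℕ) (Q : (Fin d → ZMod 2) → ZMod 2)
    (a : Fin d → ZMod 2) (A : QueryAlgorithm (Fin d → ZMod 2) (ZMod 2))
    (h : List (Fin d → ZMod 2)) : Finset (Fin d → ZMod 2) :=
  univ.filter fun b => (∀ y ∈ h, b ⬝ᵥ y = a ⬝ᵥ y) ∧
    A.verdict (spanStrategy d t) (fun x => Q x + b ⬝ᵥ x) h = true

lemma mem_acceptedShifts {d t : ℕ} {Q : (Fin d → ZMod 2) → ZMod 2} {a b : Fin d → ZMod 2}
    {A : QueryAlgorithm (Fin d → ZMod 2) (ZMod 2)} {h : List (Fin d → ZMod 2)} :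
    b ∈ acceptedShifts t Q a A h ↔ (∀ y ∈ h, b ⬝ᵥ y = a ⬝ᵥ y) ∧
      A.verdict (spanStrategy d t) (fun x => Q x + b ⬝ᵥ x) h = true := by
  simp only [acceptedShifts, mem_filter, mem_univ, true_and]

/-- The algorithm stays within the number of queries for which the span of the queries has
at most `t` points, on all sums of `Q` with a linear function that agrees with that of `a`
on `h`. -/
def WithinBudget {d : ℕ} (t : ℕ) (Q : (Fin d → ZMod 2) → ZMod 2)
    (a : Fin d → ZMod 2) (A : QueryAlgorithm (Fin d → ZMod 2) (ZMod 2))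
    (h : List (Fin d → ZMod 2)) : Prop :=
  ∀ b : Fin d → ZMod 2, (∀ y ∈ h, b ⬝ᵥ y = a ⬝ᵥ y) →
    2 ^ (A.numQueries (spanStrategy d t) (fun x => Q x + b ⬝ᵥ x) h + h.length) ≤ t

section Step

variable {d t : ℕ} {Q : (Fin d → ZMod 2) → ZMod 2} {a x : Fin d → ZMod 2}
  {next : Option (ZMod 2) → QueryAlgorithm (Fin d → ZMod 2) (ZMod 2)}
  {h : List (Fin d → ZMod 2)}

lemma WithinBudget.pow_length_le (H : WithinBudget t Q a (.query x next) h) :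
    2 ^ h.length ≤ t :=
  (Nat.pow_le_pow_right two_pos (Nat.le_add_left _ _)).trans (H a fun _ _ => rfl)

/-- A query moves from the remaining count to the history, so the exponent is unchanged. A common
answer `r` sends all functions consistent with `a'` into the same subtree. -/
lemma WithinBudget.after_query (H : WithinBudget t Q a (.query x next) h) {r : Option (ZMod 2)}
    {a' : Fin d → ZMod 2} (ha' : ∀ y ∈ h, a' ⬝ᵥ y = a ⬝ᵥ y)
    (hr : ∀ b : Fin d → ZMod 2, (∀ y ∈ x :: h, b ⬝ᵥ y = a' ⬝ᵥ y) →
      (spanStrategy d t).answer (fun z => Q z + b ⬝ᵥ z) h x = r) :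
    WithinBudget t Q a' (next r) (x :: h) := by
  intro b hb
  have := H b fun y hy => (hb y (List.mem_cons_of_mem _ hy)).trans (ha' y hy)
  rw [QueryAlgorithm.numQueries, hr b hb] at this
  rwa [List.length_cons, ← add_assoc, add_right_comm]

/-- If the answer is determined by the values on `h`, a query in the span of `h` changes
nothing. -/
lemma acceptedShifts_query_of_mem (hx : x ∈ listSpan h) {r : Option (ZMod 2)}
    (hr : ∀ b : Fin d → ZMod 2, (spanStrategy d t).answer (fun z => Q z + b ⬝ᵥ z) h x = r) :
    acceptedShifts t Q a (.query x next) h = acceptedShifts t Q a (next r) (x :: h) := by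
  ext b
  simp only [mem_acceptedShifts, QueryAlgorithm.verdict, hr b,
    List.forall_mem_cons]
  constructor
  · rintro ⟨hb, hv⟩
    exact ⟨⟨dotProduct_eq_of_mem_listSpan hb hx, hb⟩, hv⟩
  · rintro ⟨⟨-, hb⟩, hv⟩
    exact ⟨hb, hv⟩

/-- A query outside of the span of `h` splits the linear functions by the answer. -/
lemma card_acceptedShifts_query_of_notMem (hx : x ∉ listSpan h) {a' : ZMod 2 → Fin d → ZMod 2}
    (ha' : ∀ c, ∀ y ∈ h, a' c ⬝ᵥ y = a ⬝ᵥ y) (hax : ∀ c, a' c ⬝ᵥ x = c - Q x) :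
    (acceptedShifts t Q a (.query x next) h).card =
      ∑ c, (acceptedShifts t Q (a' c) (next (some c)) (x :: h)).card := by
  rw [card_eq_sum_card_fiberwise (f := fun b => Q x + b ⬝ᵥ x) (t := univ) (by simp)]
  refine sum_congr rfl fun c _ => congrArg card ?_
  have hans (f : (Fin d → ZMod 2) → ZMod 2) :
      (spanStrategy d t).answer f h x = some (f x) :=
    if_neg fun hm => hx (mem_listSpan_of_mem_erased _ _ hm)
  ext b
  simp only [mem_filter, mem_acceptedShifts, QueryAlgorithm.verdict, hans,
    List.forall_mem_cons, hax]
  constructor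
  · rintro ⟨⟨hb, hv⟩, rfl⟩
    exact ⟨⟨by ring, fun y hy => (hb y hy).trans (ha' _ y hy).symm⟩, hv⟩
  · rintro ⟨⟨hbx, hb⟩, hv⟩
    have hc : Q x + b ⬝ᵥ x = c := by rw [hbx]; ring
    rw [hc]
    exact ⟨⟨fun y hy => (hb y hy).trans (ha' c y hy), hv⟩, rfl⟩

end Step

/-- Against the strategy that erases spans, an algorithm with few queries cannot tell apart
random linear functions and random linear functions shifted by `Q`. -/
theorem card_acceptedShifts_eq {d t : ℕ} {Q Q' : (Fin d → ZMod 2) → ZMod 2} (hQ : Q 0 = 0)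
    (hQ' : Q' 0 = 0) (A : QueryAlgorithm (Fin d → ZMod 2) (ZMod 2))
    (h : List (Fin d → ZMod 2)) (a a' : Fin d → ZMod 2) (H : WithinBudget t Q a A h)
    (H' : WithinBudget t Q' a' A h) :
    (acceptedShifts t Q a A h).card = (acceptedShifts t Q' a' A h).card := by
  induction A generalizing h a a' with
  | output v =>
    cases v
    · simp [acceptedShifts, QueryAlgorithm.verdict]
    · simp only [acceptedShifts, QueryAlgorithm.verdict, and_true]
      -- Both sets are cosets of the annihilator of `h`, so a translation matches them.
      refine card_bij (fun b _ => b + (a' - a)) ?_ (fun _ _ _ _ hb => add_right_cancel hb) ?_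
      · intro b hb
        simp only [mem_filter, mem_univ, true_and] at hb ⊢
        intro y hy
        rw [add_dotProduct, sub_dotProduct, hb y hy, add_sub_cancel]
      · intro b hb
        simp only [mem_filter, mem_univ, true_and] at hb ⊢
        refine ⟨b - (a' - a), fun y hy => ?_, sub_add_cancel _ _⟩
        rw [sub_dotProduct, sub_dotProduct, hb y hy, sub_sub_cancel]
  | query x next ih =>
    by_cases hx : x ∈ listSpan h
    -- The same `r` serves `Q` and `Q'`, so both runs continue in the same subtree.
    · obtain ⟨r, hr⟩ : ∃ r, ∀ P : (Fin d → ZMod 2) → ZMod 2, P 0 = 0 → ∀ b : Fin d → ZMod 2,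
          (spanStrategy d t).answer (fun z => P z + b ⬝ᵥ z) h x = r := by
        by_cases h0 : h = []
        · subst h0
          -- The only unerased point of the span is a first query at `0`; here the vanishing of `Q`
          -- and `Q'` at `0` is needed.
          have hx0 : x = 0 := by simpa [listSpan] using hx
          exact ⟨some 0, fun P hP b => by
            simp [ErasureStrategy.answer, ErasureStrategy.erased, hx0, hP]⟩
        · exact ⟨none, fun P _ b => if_pos ((mem_erased_iff _ h0 H.pow_length_le x).2 hx)⟩
      rw [acceptedShifts_query_of_mem hx (hr Q hQ), acceptedShifts_query_of_mem hx (hr Q' hQ')]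
      exact ih r _ _ _ (H.after_query (fun _ _ => rfl) fun b _ => hr Q hQ b)
        (H'.after_query (fun _ _ => rfl) fun b _ => hr Q' hQ' b)
    -- The two sides are paired by the answer `c`, not by the vector: `u c` and `u' c` represent the
    -- functions answering `c` at `x`.
    · choose u hu hux using fun c => exists_dotProduct_eq a hx (c - Q x)
      choose u' hu' hux' using fun c => exists_dotProduct_eq a' hx (c - Q' x)
      rw [card_acceptedShifts_query_of_notMem hx hu hux,
        card_acceptedShifts_query_of_notMem hx hu' hux']
      have hans (P : (Fin d → ZMod 2) → ZMod 2) (c : ZMod 2) (v b : Fin d → ZMod 2)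
          (hv : v ⬝ᵥ x = c - P x) (hb : ∀ y ∈ x :: h, b ⬝ᵥ y = v ⬝ᵥ y) :
          (spanStrategy d t).answer (fun z => P z + b ⬝ᵥ z) h x = some c := by
        rw [ErasureStrategy.answer, if_neg fun hm => hx (mem_listSpan_of_mem_erased _ _ hm),
          hb x List.mem_cons_self, hv, add_sub_cancel]
      exact sum_congr rfl fun c _ => ih (some c) _ _ _
        (H.after_query (hu c) fun b hb => hans Q c _ b (hux c) hb)
        (H'.after_query (hu' c) fun b hb => hans Q' c _ b (hux' c) hb)

lemma dotProduct_mem_linearFunctions {d : ℕ} (a : Fin d → ZMod 2) :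
    (fun x => a ⬝ᵥ x) ∈ linearFunctions d := by
  refine ⟨univ.filter fun i => a i ≠ 0, fun x => ?_⟩
  rw [sum_filter]
  refine sum_congr rfl fun i _ => ?_
  split_ifs with hi
  · rw [show a i = 1 from Fin.eq_one_of_ne_zero (a i) hi, one_mul]
  · rw [not_not.1 hi, zero_mul]

/-- The sum of `x i * x j` and a linear function is far from linear. -/
lemma isFar_mul_add_dotProduct {d : ℕ} {i j : Fin d} (hij : i ≠ j) {ε : ℝ} (hε : ε ≤ 1 / 4)
    (a : Fin d → ZMod 2) :
    IsFar ε (linearFunctions d) fun x => x i * x j + a ⬝ᵥ x := by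
  rintro g ⟨I, hg⟩
  have gadd (x y) : g (x + y) = g x + g y := by simp [hg, sum_add_distrib]
  set B := univ.filter fun x : Fin d → ZMod 2 => x i * x j + a ⬝ᵥ x ≠ g x with hB
  let u : Fin d → ZMod 2 := Pi.single i 1
  let v : Fin d → ZMod 2 := Pi.single j 1
  -- The mixed second difference of `x i * x j` in directions `u`, `v` is `1`, while that of a
  -- linear function is `0`. So `B` meets every translate `x + s`, and four translates of `B` cover
  -- the space.
  let s : Finset (Fin d → ZMod 2) := {0, u, v, u + v}
  have hcover : (univ : Finset (Fin d → ZMod 2)) ⊆ s.biUnion fun w => B.image (· - w) := by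
    intro x _
    by_contra hx
    have hne (w) (hw : w ∈ s) : (x + w) i * (x + w) j + a ⬝ᵥ (x + w) = g (x + w) := by
      by_contra hxw
      refine hx (mem_biUnion.2 ⟨w, hw, mem_image.2 ⟨x + w, ?_, add_sub_cancel_right _ _⟩⟩)
      simpa [hB] using hxw
    have h0 := hne 0 (by simp [s])
    have h1 := hne u (by simp [s])
    have h2 := hne v (by simp [s])
    have h3 := hne (u + v) (by simp [s])
    simp only [gadd, dotProduct_add, Pi.add_apply, Pi.zero_apply, add_zero, u, v, Pi.single_eq_same,
      Pi.single_eq_of_ne hij, Pi.single_eq_of_ne hij.symm, zero_add] at h0 h1 h2 h3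
    have : (1 : ZMod 2) = 0 := by linear_combination h0 - h1 - h2 + h3
    exact one_ne_zero this
  have hcard : Fintype.card (Fin d → ZMod 2) ≤ 4 * B.card :=
    calc Fintype.card (Fin d → ZMod 2) ≤ _ := card_le_card hcover
      _ ≤ s.card * B.card := card_biUnion_le_card_mul _ _ _ fun _ _ => card_image_le
      _ ≤ 4 * B.card := Nat.mul_le_mul_right _ card_le_four
  have hpos : (0 : ℝ) < Fintype.card (Fin d → ZMod 2) := by exact_mod_cast Fintype.card_pos
  rw [le_div_iff₀ hpos]
  have : (Fintype.card (Fin d → ZMod 2) : ℝ) ≤ 4 * B.card := by exact_mod_cast hcard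
  nlinarith

/-- The expected number of the given functions on which a random algorithm has the verdict `v`. -/
lemma sum_map_verdict {α β ι : Type} {t : ℕ} [DecidableEq α] [Fintype ι]
    (T : PMF (QueryAlgorithm α β)) (S : ErasureStrategy α β t) (f : ι → α → β) (v : Bool) :
    ∑ b, (T.map fun A => A.verdict S (f b) []) v =
      ∑' A, T A * ((univ.filter fun b => A.verdict S (f b) [] = v).card : ENNReal) := by
  simp_rw [PMF.map_apply]
  rw [← Summable.tsum_finsetSum fun _ _ => ENNReal.summable]
  refine tsum_congr fun A => ?_
  simp only [eq_comm (a := v)]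
  rw [mul_comm, ← nsmul_eq_mul, ← sum_const, sum_filter]

/-- A tester whose number of queries is always at most `log₂ t` does not exist, if some `Q` with
`Q 0 = 0` has all its shifts by linear functions far from linear. -/
theorem not_isResilientTester_of_numQueries_le {d t : ℕ} {ε : ℝ}
    {Q : (Fin d → ZMod 2) → ZMod 2} (hQ : Q 0 = 0)
    (hfar : ∀ a : Fin d → ZMod 2, IsFar ε (linearFunctions d) fun x => Q x + a ⬝ᵥ x)
    (T : PMF (QueryAlgorithm (Fin d → ZMod 2) (ZMod 2)))
    (hq : ∀ A ∈ T.support, ∀ f, 2 ^ A.numQueries (spanStrategy d t) f [] ≤ t) :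
    ¬ IsResilientTester t ε (linearFunctions d) T := by
  intro hT
  set N := Fintype.card (Fin d → ZMod 2) with hN
  let f (b : Fin d → ZMod 2) : (Fin d → ZMod 2) → ZMod 2 := fun x => b ⬝ᵥ x
  let g (b : Fin d → ZMod 2) : (Fin d → ZMod 2) → ZMod 2 := fun x => Q x + b ⬝ᵥ x
  have hacc : (N : ENNReal) * (2 / 3) ≤
      ∑ b, (T.map fun A => A.verdict (spanStrategy d t) (f b) []) true := by
    rw [hN, ← card_univ, ← nsmul_eq_mul]
    exact card_nsmul_le_sum _ _ _ fun b _ => (hT _ _).1 (dotProduct_mem_linearFunctions b)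
  have hrej : (N : ENNReal) * (2 / 3) ≤
      ∑ b, (T.map fun A => A.verdict (spanStrategy d t) (g b) []) false := by
    rw [hN, ← card_univ, ← nsmul_eq_mul]
    exact card_nsmul_le_sum _ _ _ fun b _ => (hT _ _).2 (hfar b)
  have hsum := add_le_add hacc hrej
  rw [sum_map_verdict, sum_map_verdict, ← ENNReal.tsum_add] at hsum
  -- Equal acceptance counts turn accepted linear functions plus rejected shifts into all `N`
  -- vectors. Off the support the budget is unknown, but the weight is zero.
  have hterm (A : QueryAlgorithm (Fin d → ZMod 2) (ZMod 2)) :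
      T A * ((univ.filter fun b => A.verdict (spanStrategy d t) (f b) [] = true).card : ENNReal) +
        T A * ((univ.filter fun b => A.verdict (spanStrategy d t) (g b) [] = false).card :
          ENNReal) = T A * N := by
    by_cases hA : A ∈ T.support
    · have heq := card_acceptedShifts_eq (t := t) (Q := fun _ => 0) (Q' := Q) rfl hQ A [] 0 0
        (fun b _ => hq A hA _) (fun b _ => hq A hA _)
      simp only [acceptedShifts, List.not_mem_nil, false_imp_iff, implies_true, true_and,
        zero_add] at heq
      have hsplit := card_filter_add_card_filter_not (s := univ)
        (fun b => A.verdict (spanStrategy d t) (g b) [] = true)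
      simp only [Bool.not_eq_true, card_univ] at hsplit
      rw [← mul_add, heq, hN, ← hsplit, Nat.cast_add]
    · rw [(T.apply_eq_zero_iff A).2 hA, zero_mul, zero_mul, zero_mul, add_zero]
  rw [tsum_congr hterm, ENNReal.tsum_mul_right, T.tsum_coe, one_mul] at hsum
  -- What remains is `N * (2/3 + 2/3) ≤ N` with `N > 0`.
  have hreal := ENNReal.toReal_mono (ENNReal.natCast_ne_top N) hsum
  rw [← mul_add, ENNReal.toReal_mul, ENNReal.toReal_add (by finiteness) (by finiteness)] at hreal
  have hpos : (0 : ℝ) < N := by exact_mod_cast Fintype.card_pos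
  simp only [ENNReal.toReal_natCast, ENNReal.toReal_div, ENNReal.toReal_ofNat] at hreal
  linarith

end OnlineErasure

/-- The worst-case number of queries exceeds `log₂ t`: on some input, against some strategy of a
`t`-online-erasure oracle, more than `log₂ t` queries are made with positive probability. -/
theorem theorem1p3 (d t : ℕ) (hd : 2 ≤ d) (ht : 1 ≤ t) (ε : ℝ) (hε : 0 < ε) (hε' : ε ≤ 1 / 4)
    (T : PMF (OnlineErasure.QueryAlgorithm (Fin d → ZMod 2) (ZMod 2)))
    (hT : OnlineErasure.IsResilientTester t ε (OnlineErasure.linearFunctions d) T) :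
    ∃ (f : (Fin d → ZMod 2) → ZMod 2)
      (S : OnlineErasure.ErasureStrategy (Fin d → ZMod 2) (ZMod 2) t),
      ∃ A ∈ T.support, Real.logb 2 (t : ℝ) < (A.numQueries S f [] : ℝ) := by
  by_contra! hcon
  have hij : (⟨0, by omega⟩ : Fin d) ≠ ⟨1, by omega⟩ := by simp
  refine OnlineErasure.not_isResilientTester_of_numQueries_le
    (Q := fun x => x ⟨0, by omega⟩ * x ⟨1, by omega⟩) (by simp)
    (OnlineErasure.isFar_mul_add_dotProduct hij hε') T (fun A hA f => ?_) hT
  have hle := hcon f (OnlineErasure.spanStrategy d t) A hA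
  rw [Real.le_logb_iff_rpow_le one_lt_two (by exact_mod_cast ht), Real.rpow_natCast] at hle
  exact_mod_cast hle
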